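/- Let $n\ge 2$ and let $\Sigma_n$ be the $(n+1)$-polygon with one orbifold point of order three, that is, a closed disk with $n+1$ marked points on its boundary, no punctures, and one orbifold point $\times$ in its interior. An arc of $\Sigma_n$ is a curve in $\Sigma_n$ joining marked points, which does not meet itself except that its end points may coincide, does not meet $\times$, meets the marked points only in its end points, is not homotopic to a boundary segment (relative to the marked points and $\times$), and, if it cuts out a monogon, then that monogon contains $\times$; in this last case it is called a pending arc. Arcs are considered up to isotopy relative to the marked points and $\times$, parametrization and orientation. Two arcs are compatible if they are isotopic or have isotopic representatives that do not intersect outside the marked points. A triangulation $\tau$ of $\Sigma_n$ is a maximal collection of pairwise compatible arcs. It contains exactly one pending arc. Its triangles are the regions into which the arcs of $\tau$ other than the pending arc cut $\Sigma_n$: ordinary triangles, bounded by three sides, and one orbifold triangle, a digon containing $\times$ and the pending arc; its three sides are the two sides of the digon and the pending arc. A triangle is internal if none of its sides is a boundary segment. Let $Q(\tau)$ be the quiver whose vertices are the arcs of $\tau$, with, for each triangle $\Delta$ of $\tau$, an arrow $j\to i$ for each pair of sides $i,j$ of $\Delta$ that are arcs of $\tau$ and such that $i$ succeeds $j$ in the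 clockwise orientation of $\Delta$, together with a loop $\varepsilon$ at the pending arc. Each internal triangle $\Delta$ defines a 3-cycle $c_\Delta b_\Delta a_\Delta$ of $Q(\tau)$, up to rotation; let $$S(\tau)=\sum_{\Delta\ \mathrm{internal}} c_\Delta b_\Delta a_\Delta+\varepsilon^3 .$$ Let $\mathbb{C}\langle\langle Q(\tau)\rangle\rangle=\prod_{m\ge 0}\mathbb{C}C_m$ be the completed path algebra, where $C_m$ is the set of paths of length $m$, let $\mathfrak{M}=\prod_{m\ge 1}\mathbb{C}C_m$, and for an arrow $a$ let $\partial_a$ be the cyclic derivative, $\partial_a(a_m\cdots a_1)=\sum_{k:\,a_k=a}a_{k-1}\cdots a_1a_m\cdots a_{k+1}$ on cycles. The algebra $\Lambda(\tau)$ is the Jacobian algebra of $(Q(\tau),S(\tau))$, that is, the quotient of $\mathbb{C}\langle\langle Q(\tau)\rangle\rangle$ by the closure, in the $\mathfrak{M}$-adic topology, of the two-sided ideal generated by all $\partial_a(S(\tau))$. Then, for every triangulation $\tau$ of $\Sigma_n$, the $\mathbb{C}$-algebra $\Lambda(\tau)$ is finite-dimensional. -/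

import Mathlib

noncomputable section

namespace OrbifoldPolygon

/-! ### Completed path algebras -/

section PathAlgebra

variable {V : Type*} [Quiver V]

/-- All factorizations `p = q r` of a path (first `q`, then `r`), one for each of the
`length p + 1` points at which `p` can be cut. -/
def splits {i : V} : ∀ {j : V}, Quiver.Path i j → List (Σ k : V, Quiver.Path i k × Quiver.Path k j)
  | _, .nil => [⟨i, .nil, .nil⟩]
  | j, .cons p e =>
      ⟨j, p.cons e, .nil⟩ :: (splits p).map fun s => ⟨s.1, s.2.1, s.2.2.cons e⟩

/-- The coefficient at `p` of a product: the sum of `f r * g q` over the factorizations of `p`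
into `q` followed by `r` (paths are composed like functions, from right to left). -/
def convolution {i j : V} (f : ∀ k, Quiver.Path k j → ℂ) (g : ∀ k, Quiver.Path i k → ℂ) (p : Quiver.Path i j) : ℂ :=
  ((splits p).map fun s => f s.1 s.2.2 * g s.1 s.2.1).sum

theorem convolution_nil {i : V} (f : ∀ k, Quiver.Path k i → ℂ) (g : ∀ k, Quiver.Path i k → ℂ) :
    convolution f g .nil = f i .nil * g i .nil := by
  simp [convolution, splits]

theorem convolution_cons {i j k : V} (f : ∀ l, Quiver.Path l k → ℂ) (g : ∀ l, Quiver.Path i l → ℂ)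
    (p : Quiver.Path i j) (e : j ⟶ k) :
    convolution f g (p.cons e) =
      f k .nil * g k (p.cons e) + convolution (fun l r => f l (r.cons e)) g p := by
  simp [convolution, splits, Function.comp_def]

theorem convolution_add_left {i j : V} (f f' : ∀ k, Quiver.Path k j → ℂ) (g : ∀ k, Quiver.Path i k → ℂ)
    (p : Quiver.Path i j) :
    convolution (fun k r => f k r + f' k r) g p = convolution f g p + convolution f' g p := by
  simp [convolution, add_mul, List.sum_map_add]

theorem convolution_add_right {i j : V} (f : ∀ k, Quiver.Path k j → ℂ) (g g' : ∀ k, Quiver.Path i k → ℂ)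
    (p : Quiver.Path i j) :
    convolution f (fun k q => g k q + g' k q) p = convolution f g p + convolution f g' p := by
  simp [convolution, mul_add, List.sum_map_add]

theorem convolution_smul_left {i j : V} (c : ℂ) (f : ∀ k, Quiver.Path k j → ℂ) (g : ∀ k, Quiver.Path i k → ℂ)
    (p : Quiver.Path i j) :
    convolution (fun k r => c * f k r) g p = c * convolution f g p := by
  simp [convolution, mul_assoc, List.sum_map_mul_left]

theorem convolution_smul_right {i j : V} (c : ℂ) (f : ∀ k, Quiver.Path k j → ℂ) (g : ∀ k, Quiver.Path i k → ℂ)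
    (p : Quiver.Path i j) :
    convolution f (fun k q => c * g k q) p = c * convolution f g p := by
  simp [convolution, mul_left_comm _ c, List.sum_map_mul_left]

theorem convolution_assoc {i j : V} (f : ∀ k, Quiver.Path k j → ℂ) (g : ∀ k l, Quiver.Path k l → ℂ)
    (h : ∀ k, Quiver.Path i k → ℂ) (p : Quiver.Path i j) :
    convolution (fun k r => convolution f (g k) r) h p =
      convolution f (fun k q => convolution (fun l => g l k) h q) p := by
  induction p with
  | nil => simp [convolution_nil, mul_assoc]
  | cons p e ih =>
    simp only [convolution_cons, convolution_nil, convolution_add_left, convolution_smul_left, ih]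
    ring

/-- The coefficients of the unit, that is of the sum of all paths of length zero. -/
def oneCoeff {i : V} : ∀ {j : V}, Quiver.Path i j → ℂ
  | _, .nil => 1
  | _, .cons _ _ => 0

theorem convolution_zero_left {i j : V} (g : ∀ k, Quiver.Path i k → ℂ) (p : Quiver.Path i j) :
    convolution (fun _ _ => 0) g p = 0 := by
  simp [convolution]

theorem convolution_zero_right {i j : V} (f : ∀ k, Quiver.Path k j → ℂ) (p : Quiver.Path i j) :
    convolution f (fun _ _ => 0) p = 0 := by
  simp [convolution]

theorem convolution_one_left {i j : V} (g : ∀ k, Quiver.Path i k → ℂ) (p : Quiver.Path i j) :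
    convolution (fun _ r => oneCoeff r) g p = g j p := by
  cases p with
  | nil => simp [convolution_nil, oneCoeff]
  | cons p e => simp [convolution_cons, oneCoeff, convolution_zero_left]

theorem convolution_one_right {i j : V} (f : ∀ k, Quiver.Path k j → ℂ) (p : Quiver.Path i j) :
    convolution f (fun _ q => oneCoeff q) p = f i p := by
  induction p with
  | nil => simp [convolution_nil, oneCoeff]
  | cons p e ih =>
    rw [convolution_cons, ih]
    simp [oneCoeff]

variable (V) in
/-- The completed path algebra `ℂ⟨⟨Q⟩⟩ = ∏ₘ ℂCₘ` of a (finite) quiver `Q` with vertex set `V`,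
where `Cₘ` is the set of paths of length `m`: an element is an arbitrary family of coefficients
indexed by the paths of `Q`. -/
def CompletedPathAlgebra : Type _ := ∀ i j : V, Quiver.Path i j → ℂ

namespace CompletedPathAlgebra

instance : AddCommGroup (CompletedPathAlgebra V) :=
  inferInstanceAs (AddCommGroup (∀ i j : V, Quiver.Path i j → ℂ))

instance : Module ℂ (CompletedPathAlgebra V) :=
  inferInstanceAs (Module ℂ (∀ i j : V, Quiver.Path i j → ℂ))

instance : Mul (CompletedPathAlgebra V) :=
  ⟨fun f g i j p => convolution (fun k => f k j) (g i) p⟩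

instance : One (CompletedPathAlgebra V) := ⟨fun _ _ p => oneCoeff p⟩

instance : Ring (CompletedPathAlgebra V) :=
  { (inferInstance : AddCommGroup (CompletedPathAlgebra V)),
    (inferInstance : Mul (CompletedPathAlgebra V)),
    (inferInstance : One (CompletedPathAlgebra V)) with
    left_distrib := fun f g h => funext fun i => funext fun j => funext fun p =>
      convolution_add_right (fun k => f k j) (g i) (h i) p
    right_distrib := fun f g h => funext fun i => funext fun j => funext fun p =>
      convolution_add_left (fun k => f k j) (fun k => g k j) (h i) p
    zero_mul := fun g => funext fun i => funext fun _ => funext fun p =>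
      convolution_zero_left (g i) p
    mul_zero := fun f => funext fun _ => funext fun j => funext fun p =>
      convolution_zero_right (fun k => f k j) p
    mul_assoc := fun f g h => funext fun i => funext fun j => funext fun p =>
      convolution_assoc (fun k => f k j) g (h i) p
    one_mul := fun g => funext fun i => funext fun _ => funext fun p =>
      convolution_one_left (g i) p
    mul_one := fun f => funext fun _ => funext fun j => funext fun p =>
      convolution_one_right (fun k => f k j) p }

instance : Algebra ℂ (CompletedPathAlgebra V) :=
  Algebra.ofModule
    (fun c f g => funext fun i => funext fun j => funext fun p =>
      convolution_smul_left c (fun k => f k j) (g i) p)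
    (fun c f g => funext fun i => funext fun j => funext fun p =>
      convolution_smul_right c (fun k => f k j) (g i) p)

end CompletedPathAlgebra

theorem convolution_eq_zero_left {l : ℕ} {i j : V} (f : ∀ k, Quiver.Path k j → ℂ)
    (g : ∀ k, Quiver.Path i k → ℂ) (hf : ∀ k (r : Quiver.Path k j), r.length < l → f k r = 0)
    (p : Quiver.Path i j) (hp : p.length < l) : convolution f g p = 0 := by
  induction p generalizing l with
  | nil => simp [convolution_nil, hf _ _ hp]
  | @cons b c p e ih =>
    have h0 : f c .nil = 0 := hf c .nil (by simpa using Nat.zero_lt_of_lt hp)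
    rw [convolution_cons, h0, zero_mul, zero_add]
    obtain ⟨m, rfl⟩ : ∃ m, l = m + 1 := ⟨l - 1, by have := Nat.zero_lt_of_lt hp; omega⟩
    exact ih (l := m) _ (fun k r hr => hf k (r.cons e) (by simpa using hr)) (by simpa using hp)

theorem convolution_eq_zero_right {l : ℕ} {i j : V} (f : ∀ k, Quiver.Path k j → ℂ)
    (g : ∀ k, Quiver.Path i k → ℂ) (hg : ∀ k (q : Quiver.Path i k), q.length < l → g k q = 0)
    (p : Quiver.Path i j) (hp : p.length < l) : convolution f g p = 0 := by
  induction p with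
  | nil => simp [convolution_nil, hg _ _ hp]
  | cons p e ih =>
    rw [convolution_cons, hg _ _ hp, mul_zero, zero_add]
    exact ih _ (by rw [Quiver.Path.length_cons] at hp; omega)

variable (V) in
/-- The power `𝔐ˡ = ∏_{m ≥ l} ℂCₘ` of the ideal `𝔐` generated by the arrows. -/
def arrowIdealPow (l : ℕ) : TwoSidedIdeal (CompletedPathAlgebra V) :=
  TwoSidedIdeal.mk' {f | ∀ (i j : V) (p : Quiver.Path i j), p.length < l → f i j p = 0}
    (fun _ _ _ _ => rfl)
    (fun {f g} hf hg i j p hp => by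
      change f i j p + g i j p = 0
      rw [hf i j p hp, hg i j p hp, add_zero])
    (fun {f} hf i j p hp => by
      change -f i j p = 0
      rw [hf i j p hp, neg_zero])
    (fun {f g} hg i j p hp =>
      convolution_eq_zero_right (fun k => f k j) (g i) (fun k q hq => hg i k q hq) p hp)
    (fun {f g} hf i j p hp =>
      convolution_eq_zero_left (fun k => f k j) (g i) (fun k r hr => hf k j r hr) p hp)

/-- The closure `⋂ₗ (I + 𝔐ˡ)` of a two-sided ideal in the `𝔐`-adic topology. -/
def adicClosure (I : TwoSidedIdeal (CompletedPathAlgebra V)) :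
    TwoSidedIdeal (CompletedPathAlgebra V) :=
  ⨅ l : ℕ, I ⊔ arrowIdealPow V l

/-! ### Jacobian algebras -/

variable (V) in
/-- A potential: a possibly infinite linear combination of cycles. -/
abbrev Potential : Type _ := ∀ i : V, Quiver.Path i i → ℂ

/-- The sum of a set of cycles, as a potential. -/
def sumOfCycles (C : Set (Σ i : V, Quiver.Path i i)) : Potential V :=
  fun i => Set.indicator {c | (⟨i, c⟩ : Σ i : V, Quiver.Path i i) ∈ C} 1

open Classical in
/-- The cyclic derivative with respect to an arrow `a : s ⟶ t`, extended linearly and continuously.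
A pair consisting of a cycle `c` and an occurrence of `a` in `c` contributes the path `p` obtained
by deleting that occurrence and reading `c` cyclically from there. Thus `p` runs from `t` to `s`,
and the pairs which contribute `p` correspond to the factorizations of `p` into `x` followed by `y`,
with `c` equal to `y`, then `a`, then `x`. -/
def cyclicDerivative {s t : V} (a : s ⟶ t) (S : Potential V) : CompletedPathAlgebra V :=
  fun i j p =>
    if h : i = t ∧ j = s then
      ((splits (p.cast h.1 h.2)).map fun x => S x.1 ((x.2.2.cons a).comp x.2.1)).sum
    else 0

/-- The Jacobian ideal: the closure of the two-sided ideal generated by the cyclic derivatives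
of the potential with respect to all arrows. -/
def jacobianIdeal (S : Potential V) : TwoSidedIdeal (CompletedPathAlgebra V) :=
  adicClosure (TwoSidedIdeal.span
    {f | ∃ (s t : V) (a : s ⟶ t), f = cyclicDerivative a S})

/-- The Jacobian algebra of a quiver with potential. -/
abbrev JacobianAlgebra (S : Potential V) : Type _ := (jacobianIdeal S).ringCon.Quotient

end PathAlgebra

/-! ### The polygon with one orbifold point

The surface `Σₙ` is the closed unit disk with the `n + 1` marked points
`v_a = exp (2πi a / (n + 1))`, `a ∈ ℤ/(n+1)`, which are in counterclockwise order, and the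
orbifold point `0`. The map `z ↦ exp (2πi z / (n + 1))` is the universal covering of the disk
without the orbifold point by the closed upper half plane; the marked points lift to the integers.
-/

/-- Curves in `Σₙ` joining marked points, up to isotopy relative to the marked points and the
orbifold point: the curve with `start = a` and `len = d` goes from `v_a` to `v_{a+d}`, has the
orbifold point on its left, and has on its right the boundary path from `v_a` counterclockwise
through `d` boundary segments to `v_{a+d}`. For `len = 1` it is a boundary segment, for
`2 ≤ len ≤ n` an arc with distinct end points, and for `len = n + 1` the loop at `v_a` around the
orbifold point. Between two distinct vertices `v_a`, `v_b` there are thus two curves, one on each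
side of the orbifold point. -/
@[ext]
structure Segment (n : ℕ) where
  start : ZMod (n + 1)
  len : ℕ
  one_le_len : 1 ≤ len
  len_le : len ≤ n + 1

namespace Segment

variable {n : ℕ}

/-- The segments of the boundary circle between consecutive marked points. -/
def IsBoundary (s : Segment n) : Prop := s.len = 1

/-- The arcs: neither boundary segments nor contractible. -/
def IsArc (s : Segment n) : Prop := 2 ≤ s.len

/-- The pending arcs: loops that cut out a monogon containing the orbifold point. -/
def IsPending (s : Segment n) : Prop := s.len = n + 1

/-- The geodesic representative of the isotopy class, without its end points: the image in the
disk of the half circle in the upper half plane over the interval `[a, a + d]`. -/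
def curve (s : Segment n) : Set ℂ :=
  (fun z : ℂ => Complex.exp (2 * Real.pi * Complex.I * z / (n + 1))) ''
    {z : ℂ | 0 < z.im ∧ ‖z - ((s.start.val : ℂ) + (s.len : ℂ) / 2)‖ = (s.len : ℝ) / 2}

/-- Two arcs are compatible if they are equal or do not intersect outside the marked points.
As geodesics are in minimal position, isotopic representatives need not be considered. -/
def Compatible (s t : Segment n) : Prop := s = t ∨ Disjoint s.curve t.curve

end Segment

/-- Three vertices `v_a`, `v_{a+d}`, `v_{a+d+e}`, in counterclockwise order. In the case
`d + e = n + 1`, where `v_{a+d+e} = v_a`, they are the vertices of the orbifold triangle formed by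
the digon with vertices `v_a` and `v_{a+d}` and, inside it, the pending arc at `v_a`. -/
@[ext]
structure Triple (n : ℕ) where
  start : ZMod (n + 1)
  d : ℕ
  e : ℕ
  one_le_d : 1 ≤ d
  one_le_e : 1 ≤ e
  add_le : d + e ≤ n + 1

/-- The three sides `[v_a, v_{a+d+e}]`, `[v_{a+d}, v_{a+d+e}]`, `[v_a, v_{a+d}]`,
in clockwise order. -/
def Triple.side {n : ℕ} (Δ : Triple n) : Fin 3 → Segment n :=
  ![⟨Δ.start, Δ.d + Δ.e, by have := Δ.one_le_d; omega, Δ.add_le⟩,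
    ⟨Δ.start + Δ.d, Δ.e, Δ.one_le_e, by have := Δ.add_le; omega⟩,
    ⟨Δ.start, Δ.d, Δ.one_le_d, by have := Δ.add_le; omega⟩]

/-- A triangulation of `Σₙ`: a maximal collection of pairwise compatible arcs. -/
structure Triangulation (n : ℕ) where
  arcs : Set (Segment n)
  isArc : ∀ s ∈ arcs, s.IsArc
  compatible : ∀ s ∈ arcs, ∀ t ∈ arcs, s.Compatible t
  maximal : ∀ s : Segment n, s.IsArc → (∀ t ∈ arcs, s.Compatible t) → s ∈ arcs

namespace Triangulation

variable {n : ℕ}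

/-- A triangle of `τ`: a triple of vertices all of whose sides are boundary segments or arcs
of `τ`. -/
structure Triangle (τ : Triangulation n) extends Triple n where
  side_mem : ∀ k, (toTriple.side k).IsBoundary ∨ toTriple.side k ∈ τ.arcs

/-- A triangle is internal if none of its sides is a boundary segment. -/
def Triangle.IsInternal {τ : Triangulation n} (Δ : τ.Triangle) : Prop :=
  ∀ k, Δ.side k ∈ τ.arcs

/-- The vertices of the quiver `Q(τ)`: the arcs of `τ`. -/
@[ext]
structure Vertex (τ : Triangulation n) where
  arc : Segment n
  mem : arc ∈ τ.arcs

/-- The arrows of the quiver `Q(τ)`: in each triangle an arrow from each side to the side which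
succeeds it in the clockwise orientation, if neither of the two is a boundary segment; and a loop
at the pending arc. -/
inductive Arrow (τ : Triangulation n) : τ.Vertex → τ.Vertex → Type
  | ofTriangle (Δ : τ.Triangle) (k : Fin 3) (h : Δ.side k ∈ τ.arcs)
      (h' : Δ.side (k + 1) ∈ τ.arcs) : Arrow τ ⟨Δ.side k, h⟩ ⟨Δ.side (k + 1), h'⟩
  | loop (i : τ.Vertex) (h : i.arc.IsPending) : Arrow τ i i

/-- The quiver `Q(τ)`. -/
instance (τ : Triangulation n) : Quiver τ.Vertex := ⟨τ.Arrow⟩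

/-- The arrow from the `k`-th to the `(k+1)`-st side of an internal triangle. -/
def triangleArrow (τ : Triangulation n) (Δ : τ.Triangle) (h : Δ.IsInternal) (k : Fin 3) :
    (⟨Δ.side k, h k⟩ : τ.Vertex) ⟶ ⟨Δ.side (k + 1), h (k + 1)⟩ :=
  Arrow.ofTriangle Δ k (h k) (h (k + 1))

/-- The 3-cycle defined by an internal triangle. -/
def triangleCycle (τ : Triangulation n) (Δ : τ.Triangle) (h : Δ.IsInternal) :
    Σ i : τ.Vertex, Quiver.Path i i :=
  ⟨⟨Δ.side 0, h 0⟩,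
    ((τ.triangleArrow Δ h 0).toPath.cons (τ.triangleArrow Δ h 1)).cons (τ.triangleArrow Δ h 2)⟩

/-- The loop `ε` at the pending arc `i`. -/
def loopArrow (τ : Triangulation n) (i : τ.Vertex) (h : i.arc.IsPending) : i ⟶ i :=
  Arrow.loop i h

/-- The cycle `ε³`. -/
def loopCycle (τ : Triangulation n) (i : τ.Vertex) (h : i.arc.IsPending) :
    Σ i : τ.Vertex, Quiver.Path i i :=
  ⟨i, ((τ.loopArrow i h).toPath.cons (τ.loopArrow i h)).cons (τ.loopArrow i h)⟩

/-- The potential `S(τ)`: the sum of the 3-cycles of the internal triangles and of `ε³`. -/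
def potential (τ : Triangulation n) : Potential τ.Vertex :=
  sumOfCycles ({c | ∃ (Δ : τ.Triangle) (h : Δ.IsInternal), c = τ.triangleCycle Δ h} ∪
    {c | ∃ (i : τ.Vertex) (h : i.arc.IsPending), c = τ.loopCycle i h})

/-- The algebra `Λ(τ)`: the Jacobian algebra of `(Q(τ), S(τ))`. -/
abbrev Lam (τ : Triangulation n) : Type := JacobianAlgebra τ.potential

end Triangulation

end OrbifoldPolygon

end

noncomputable section

/-! In a triangle of `τ` call side 0 the long side: the lengths of sides 1 and 2 add up to its
length. Two triangles with a common side in the same position would have crossing sides, and so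
would triangles sharing an arc as side 1 of one and side 2 of the other. Hence an arc is side 0 of
at most one triangle, and is side 1 or side 2 of at most one triangle, in only one of these
positions. The pending arc has the maximal length and can only be a side 0.

Each arrow of an internal triangle lies in just one 3-cycle of the potential, so the cyclic
derivatives say that two consecutive arrows of the same triangle compose to zero; the loop gives `3
ε² = 0`. A nonzero path must therefore change triangle at every arc that it passes without using the
loop. Arrows 2 → 0 then lead to longer and longer arcs, an arrow 1 → 2 or the loop can occur only
once, and afterwards arrows 0 → 1 lead to shorter and shorter arcs. The function `rank` measures
this progress (`rank_lt_or_mul_mem`), and its boundedness kills all products of `2 * n + 6` arrows.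

Since the quiver is finite, the Jacobian ideal then contains a power of `𝔐`
(`arrowIdealPow_le_of_forall_word`), and the quotient is spanned by the finitely many shorter paths
(`finiteDimensional_jacobianAlgebra`). -/

namespace OrbifoldPolygon

/-! ### Paths as words in the arrows -/

section Words

variable {V : Type*} [Quiver V]

variable (V) in
/-- The arrows of a quiver, bundled with their end points. -/
abbrev AnyArrow : Type _ := Σ i j : V, i ⟶ j

/-- The arrows of a path, the last one first. -/
def word {i : V} : ∀ {j : V}, Quiver.Path i j → List (AnyArrow V)
  | _, .nil => []
  | _, .cons p e => ⟨_, _, e⟩ :: word p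

@[simp] theorem word_nil {i : V} : word (.nil : Quiver.Path i i) = [] := rfl

@[simp] theorem word_cons {i j k : V} (p : Quiver.Path i j) (e : j ⟶ k) :
    word (p.cons e) = ⟨j, k, e⟩ :: word p := rfl

@[simp] theorem word_comp {i j k : V} (p : Quiver.Path i j) (q : Quiver.Path j k) :
    word (p.comp q) = word q ++ word p := by
  induction q with
  | nil => simp
  | cons q e ih => simp [ih]

theorem length_word {i j : V} (p : Quiver.Path i j) : (word p).length = p.length := by
  induction p with
  | nil => simp
  | cons p e ih => simp [ih]

theorem word_injective {i j : V} : Function.Injective (word : Quiver.Path i j → _) := by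
  intro p
  induction p with
  | nil =>
    intro q h
    cases q with
    | nil => rfl
    | cons q f => simp at h
  | cons p e ih =>
    intro q h
    cases q with
    | nil => simp at h
    | cons q f =>
      simp only [word_cons, List.cons.injEq, Sigma.mk.injEq] at h
      obtain ⟨⟨rfl, h⟩, h'⟩ := h
      obtain ⟨-, h⟩ := Sigma.mk.inj (eq_of_heq h)
      obtain rfl := eq_of_heq h
      rw [ih h']

theorem eq_target_of_word {i j : V} {p : Quiver.Path i j} {a : AnyArrow V} {w : List (AnyArrow V)}
    (h : word p = a :: w) : j = a.2.1 := by
  cases p with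
  | nil => simp at h
  | cons p e =>
    simp only [word_cons, List.cons.injEq] at h
    rw [← h.1]

theorem eq_source_of_word {i j : V} {p : Quiver.Path i j} {a : AnyArrow V} {w : List (AnyArrow V)}
    (h : word p = w ++ [a]) : i = a.1 := by
  induction p generalizing w with
  | nil => simp at h
  | cons p e ih =>
    cases w with
    | nil =>
      simp only [word_cons, List.nil_append, List.cons.injEq] at h
      obtain ⟨rfl, h⟩ := h
      cases p with
      | nil => rfl
      | cons p f => simp at h
    | cons b w =>
      simp only [word_cons, List.cons_append, List.cons.injEq] at h
      exact ih h.2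

theorem source_eq_target_of_word {i j : V} {p : Quiver.Path i j} {a b : AnyArrow V}
    (h : word p = [a, b]) : a.1 = b.2.1 := by
  cases p with
  | nil => simp at h
  | cons p e =>
    simp only [word_cons, List.cons.injEq] at h
    rw [← h.1]
    exact eq_target_of_word h.2

/-- The empty word does not remember its base point; a nonempty one does, through the target of its
first letter. -/
theorem cycle_eq_iff_word_eq {i j : V} (c : Quiver.Path i i) (c' : Quiver.Path j j)
    (hc : c'.length ≠ 0) :
    (⟨i, c⟩ : Σ i : V, Quiver.Path i i) = ⟨j, c'⟩ ↔ word c = word c' := by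
  refine ⟨fun h => by cases h; rfl, fun h => ?_⟩
  rcases hw : word c' with _ | ⟨a, w⟩
  · rw [← length_word, hw] at hc
    simp at hc
  · obtain rfl : i = j := (eq_target_of_word (h.trans hw)).trans (eq_target_of_word hw).symm
    rw [word_injective h]

theorem length_of_mem_splits {i j : V} (p : Quiver.Path i j) :
    ∀ x ∈ splits p, x.2.1.length + x.2.2.length = p.length := by
  induction p with
  | nil => simp [splits]
  | cons p e ih =>
    intro x hx
    simp only [splits, List.mem_cons, List.mem_map] at hx
    rcases hx with rfl | ⟨y, hy, rfl⟩
    · simp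
    · simp [← ih y hy, add_assoc]

theorem finite_paths_length_lt [Finite V] [Finite (AnyArrow V)] (L : ℕ) :
    Finite {p : Σ i j : V, Quiver.Path i j // p.2.2.length < L} := by
  have : Finite {w : List (AnyArrow V) // w.length < L} := List.finite_length_lt _ L
  refine Finite.of_injective
    (fun p => (p.1.1, p.1.2.1, (⟨word p.1.2.2, by rw [length_word]; exact p.2⟩ :
      {w : List (AnyArrow V) // w.length < L}))) ?_
  rintro ⟨⟨i, j, p⟩, hp⟩ ⟨⟨i', j', p'⟩, hp'⟩ h
  simp only [Prod.mk.injEq, Subtype.mk.injEq] at h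
  obtain ⟨rfl, rfl, h⟩ := h
  rw [Subtype.mk.injEq, word_injective h]

/-! ### Arrows as elements of the completed path algebra, and powers of `𝔐` -/

open Classical in
/-- An arrow as an element of the completed path algebra. -/
def arrowElement (a : AnyArrow V) : CompletedPathAlgebra V :=
  fun _ _ p => if word p = [a] then 1 else 0

theorem mul_apply (f g : CompletedPathAlgebra V) {i j : V} (p : Quiver.Path i j) :
    (f * g) i j p = convolution (fun k => f k j) (g i) p := rfl

theorem arrowElement_mul_nil (a : AnyArrow V) (f : CompletedPathAlgebra V) (i : V) :
    (arrowElement a * f) i i .nil = 0 := by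
  simp [mul_apply, convolution_nil, arrowElement]

open Classical in
theorem arrowElement_mul_cons (a : AnyArrow V) (f : CompletedPathAlgebra V) {i j k : V}
    (p : Quiver.Path i j) (e : j ⟶ k) :
    (arrowElement a * f) i k (p.cons e) = if ⟨j, k, e⟩ = a then f i j p else 0 := by
  have h1 : ∀ l (r : Quiver.Path l j), arrowElement a l k (r.cons e) =
      (if (⟨j, k, e⟩ : AnyArrow V) = a then 1 else 0) * oneCoeff r := by
    intro l r
    cases r <;> simp [arrowElement, oneCoeff]
  rw [mul_apply, convolution_cons]
  simp only [h1]
  rw [convolution_smul_left, convolution_one_left]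
  simp [arrowElement]

open Classical in
theorem arrowElement_mul_arrowElement_apply (a b : AnyArrow V) {i j : V} (p : Quiver.Path i j) :
    (arrowElement a * arrowElement b) i j p = if word p = [a, b] then 1 else 0 := by
  cases p with
  | nil => simp [arrowElement_mul_nil]
  | cons p e =>
    rw [arrowElement_mul_cons]
    by_cases h : (⟨_, _, e⟩ : AnyArrow V) = a <;> simp [arrowElement, h]

theorem arrowElement_mul_arrowElement_eq_zero {a b : AnyArrow V} (h : a.1 ≠ b.2.1) :
    arrowElement a * arrowElement b = 0 := by
  funext i j p
  rw [arrowElement_mul_arrowElement_apply, if_neg fun hp => h (source_eq_target_of_word hp)]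
  rfl

open Classical in
/-- The part of `f` supported on the paths that end with the arrow `a`, with `a` removed. -/
def removeArrow (a : AnyArrow V) (f : CompletedPathAlgebra V) : CompletedPathAlgebra V :=
  fun i j p => if h : j = a.1 then f i a.2.1 ((p.cast rfl h).cons a.2.2) else 0

theorem mem_arrowIdealPow {l : ℕ} {f : CompletedPathAlgebra V} :
    f ∈ arrowIdealPow V l ↔
      ∀ (i j : V) (p : Quiver.Path i j), p.length < l → f i j p = 0 := by
  unfold arrowIdealPow
  exact TwoSidedIdeal.mem_mk' _ _ _ _ _ _ _

theorem removeArrow_mem {l : ℕ} {f : CompletedPathAlgebra V} (hf : f ∈ arrowIdealPow V (l + 1))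
    (a : AnyArrow V) : removeArrow a f ∈ arrowIdealPow V l := by
  rw [mem_arrowIdealPow] at hf ⊢
  intro i j p hp
  unfold removeArrow
  split_ifs with h
  · subst h
    exact hf _ _ _ (by simpa using hp)
  · rfl

theorem sum_apply {ι : Type*} (s : Finset ι) (f : ι → CompletedPathAlgebra V) {i j : V}
    (p : Quiver.Path i j) : (∑ x ∈ s, f x) i j p = ∑ x ∈ s, f x i j p := by
  classical
  induction s using Finset.induction_on with
  | empty => rfl
  | insert x s hx ih =>
    rw [Finset.sum_insert hx, Finset.sum_insert hx, ← ih]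
    rfl

theorem eq_sum_arrowElement_mul [Fintype (AnyArrow V)] {l : ℕ} {f : CompletedPathAlgebra V}
    (hf : f ∈ arrowIdealPow V (l + 1)) :
    f = ∑ a : AnyArrow V, arrowElement a * removeArrow a f := by
  classical
  funext i j p
  rw [sum_apply]
  cases p with
  | nil => simpa [arrowElement_mul_nil] using mem_arrowIdealPow.1 hf i i .nil (by simp)
  | cons p e =>
    simp only [arrowElement_mul_cons]
    simp [removeArrow]

/-- With finitely many arrows, an infinite series in `𝔐^L` is a finite sum of words of length `L`
times series: split off the last arrow of its paths `L` times. No limit is needed. -/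
theorem arrowIdealPow_le_of_forall_word [Finite (AnyArrow V)]
    (I : TwoSidedIdeal (CompletedPathAlgebra V)) (L : ℕ)
    (hI : ∀ w : List (AnyArrow V), w.length = L → (w.map arrowElement).prod ∈ I) :
    arrowIdealPow V L ≤ I := by
  have := Fintype.ofFinite (AnyArrow V)
  have key : ∀ (l : ℕ) (w : List (AnyArrow V)) (f : CompletedPathAlgebra V), w.length + l = L →
      f ∈ arrowIdealPow V l → (w.map arrowElement).prod * f ∈ I := by
    intro l
    induction l with
    | zero => exact fun w f hw _ => I.mul_mem_right _ _ (hI w hw)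
    | succ l ih =>
      intro w f hw hf
      rw [eq_sum_arrowElement_mul hf, Finset.mul_sum]
      refine sum_mem fun a _ => ?_
      have := ih (w ++ [a]) (removeArrow a f) (by simp; omega) (removeArrow_mem hf a)
      simpa [mul_assoc] using this
  intro f hf
  simpa using key L [] f (by simp) hf

/-- If no two adjacent letters had their product in `I`, the ranks would strictly decrease along the
word, and values in `{0, …, N}` allow at most `N + 1` letters. -/
theorem prod_mem_of_rank (I : TwoSidedIdeal (CompletedPathAlgebra V)) (rank : AnyArrow V → ℕ)
    (N : ℕ) (hN : ∀ a, rank a ≤ N)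
    (h : ∀ a b : AnyArrow V, rank b < rank a ∨ arrowElement a * arrowElement b ∈ I)
    (w : List (AnyArrow V)) (hw : w.length = N + 2) : (w.map arrowElement).prod ∈ I := by
  have key : ∀ (w : List (AnyArrow V)) (a : AnyArrow V),
      rank a < w.length → ((a :: w).map arrowElement).prod ∈ I := by
    intro w
    induction w with
    | nil => simp
    | cons b w ih =>
      intro a ha
      rcases h a b with hab | hab
      · have := ih b (by simp at ha; omega)
        rw [List.map_cons, List.prod_cons]
        exact I.mul_mem_left _ _ this
      · simp only [List.map_cons, List.prod_cons, ← mul_assoc]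
        exact I.mul_mem_right _ _ hab
  cases w with
  | nil => simp at hw
  | cons a w => exact key w a (by have := hN a; simp at hw; omega)

theorem finiteDimensional_jacobianAlgebra [Finite V] [Finite (AnyArrow V)] (S : Potential V)
    (L : ℕ) (h : arrowIdealPow V L ≤ jacobianIdeal S) :
    FiniteDimensional ℂ (JacobianAlgebra S) := by
  classical
  have := finite_paths_length_lt (V := V) L
  let ext : ({p : Σ i j : V, Quiver.Path i j // p.2.2.length < L} → ℂ) →ₗ[ℂ]
      CompletedPathAlgebra V :=
    { toFun := fun c i j p => if hp : p.length < L then c ⟨⟨i, j, p⟩, hp⟩ else 0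
      map_add' := fun c d => by
        funext i j p
        change (if hp : p.length < L then (c + d) ⟨⟨i, j, p⟩, hp⟩ else 0) =
          (if hp : p.length < L then c ⟨⟨i, j, p⟩, hp⟩ else 0) +
            (if hp : p.length < L then d ⟨⟨i, j, p⟩, hp⟩ else 0)
        split_ifs <;> simp
      map_smul' := fun r c => by
        funext i j p
        change (if hp : p.length < L then (r • c) ⟨⟨i, j, p⟩, hp⟩ else 0) =
          r • (if hp : p.length < L then c ⟨⟨i, j, p⟩, hp⟩ else 0)
        split_ifs <;> simp }
  let quot : CompletedPathAlgebra V →ₗ[ℂ] JacobianAlgebra S :=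
    { toFun := fun f => (f : (jacobianIdeal S).ringCon.Quotient)
      map_add' := fun _ _ => rfl
      map_smul' := fun _ _ => rfl }
  -- Truncation below length `L` changes a series by an element of `𝔐^L` only, hence not its class.
  refine Module.Finite.of_surjective (quot ∘ₗ ext) fun x => ?_
  obtain ⟨f, rfl⟩ := Quotient.exists_rep x
  refine ⟨fun p => f p.1.1 p.1.2.1 p.1.2.2, ?_⟩
  refine (RingCon.eq _).2 ?_
  rw [TwoSidedIdeal.rel_iff]
  refine h (mem_arrowIdealPow.2 fun i j p hp => ?_)
  change (if hp : p.length < L then f i j p else 0) - f i j p = 0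
  rw [dif_pos hp, sub_self]

theorem le_adicClosure (I : TwoSidedIdeal (CompletedPathAlgebra V)) : I ≤ adicClosure I :=
  le_iInf fun _ => le_sup_left

theorem cyclicDerivative_mem_jacobianIdeal (S : Potential V) {s t : V} (a : s ⟶ t) :
    cyclicDerivative a S ∈ jacobianIdeal S :=
  le_adicClosure _ (TwoSidedIdeal.subset_span ⟨s, t, a, rfl⟩)

theorem cyclicDerivative_apply_of_length_ne_two (S : Potential V)
    (hS : ∀ i (c : Quiver.Path i i), c.length ≠ 3 → S i c = 0) {s t : V} (a : s ⟶ t)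
    {i j : V} (p : Quiver.Path i j) (hp : p.length ≠ 2) : cyclicDerivative a S i j p = 0 := by
  unfold cyclicDerivative
  split_ifs with h
  · obtain ⟨rfl, rfl⟩ := h
    refine List.sum_eq_zero fun y hy => ?_
    obtain ⟨x, hx, rfl⟩ := List.mem_map.1 hy
    refine hS _ _ ?_
    have := length_of_mem_splits _ x hx
    simp only [Quiver.Path.cast_rfl_rfl] at this
    simp only [Quiver.Path.length_comp, Quiver.Path.length_cons]
    omega
  · rfl

/-- The three cut points of a path of length two give the three rotations of the 3-cycle that `a`
completes. -/
theorem cyclicDerivative_apply_cons_cons (S : Potential V) {s t k : V} (a : s ⟶ t)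
    (e : t ⟶ k) (f : k ⟶ s) :
    cyclicDerivative a S t s ((Quiver.Path.nil.cons e).cons f) =
      S s (((Quiver.Path.nil.cons a).cons e).cons f) +
      S k (((Quiver.Path.nil.cons f).cons a).cons e) +
      S t (((Quiver.Path.nil.cons e).cons f).cons a) := by
  simp [cyclicDerivative, splits, add_assoc, Quiver.Path.comp]

end Words

/-! ### Crossing geodesics -/

section Crossing

variable {n : ℕ}

/-- Two half circles over overlapping intervals, neither of which contains the other, meet. -/
theorem exists_mem_half_circles (a x k l : ℝ) (hx : 0 < x) (hxk : x < k) (hkl : k < x + l) :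
    ∃ z : ℂ, 0 < z.im ∧ ‖z - ((a : ℂ) + (k : ℂ) / 2)‖ = k / 2 ∧
      ‖z - ((a : ℂ) + x + (l : ℂ) / 2)‖ = l / 2 := by
  have hD : 0 < 2 * x + l - k := by linarith
  -- Abscissa of the intersection point relative to `a`, from equating the squared heights `u (k -
  -- u) = (u - x) (x + l - u)`.
  set u : ℝ := x * (x + l) / (2 * x + l - k) with hu
  have huD : u * (2 * x + l - k) = x * (x + l) := div_mul_cancel₀ _ hD.ne'
  have hu0 : 0 < u := div_pos (mul_pos hx (by linarith)) hD
  have huk : u < k := by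
    rw [hu, div_lt_iff₀ hD]
    nlinarith [mul_pos (sub_pos.2 hxk) (sub_pos.2 hkl)]
  have hv : 0 < u * (k - u) := mul_pos hu0 (sub_pos.2 huk)
  have hsq := Real.sq_sqrt hv.le
  have norm_eq : ∀ c r : ℝ, 0 ≤ r → (a + u - c) ^ 2 + u * (k - u) = r ^ 2 →
      ‖(⟨a + u, √(u * (k - u))⟩ : ℂ) - (c : ℂ)‖ = r := by
    intro c r hr h
    rw [← sq_eq_sq₀ (norm_nonneg _) hr, ← Complex.normSq_eq_norm_sq, Complex.normSq_apply, ← h]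
    simp only [Complex.sub_re, Complex.sub_im, Complex.ofReal_re, Complex.ofReal_im, sub_zero]
    nlinarith
  refine ⟨⟨a + u, √(u * (k - u))⟩, Real.sqrt_pos.2 hv, ?_, ?_⟩
  · have := norm_eq (a + k / 2) (k / 2) (by linarith) (by ring)
    push_cast at this
    exact this
  · have := norm_eq (a + x + l / 2) (l / 2) (by linarith) (by nlinarith)
    push_cast at this
    exact this

theorem Segment.not_compatible_of_crossing {s t : Segment n} (x : ℕ)
    (hst : t.start = s.start + x) (hx : 0 < x) (hxs : x < s.len) (hs : s.len < x + t.len) :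
    ¬ s.Compatible t := by
  rintro (rfl | h)
  · have h0 : ((x : ℕ) : ZMod (n + 1)) = 0 := by simpa using hst.symm
    rw [ZMod.natCast_eq_zero_iff] at h0
    have := Nat.le_of_dvd hx h0
    have := s.len_le
    omega
  -- The chosen lift of `t` need not be the one that meets the lift of `s`; it differs from it by
  -- the deck translation by `m * (n + 1)`, under which the covering map is invariant.
  · obtain ⟨m, hm⟩ : ∃ m : ℤ, (t.start.val : ℤ) = s.start.val + x + m * (n + 1) := by
      have : (((t.start.val : ℤ) - (s.start.val + x) : ℤ) : ZMod (n + 1)) = 0 := by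
        push_cast
        simp [hst]
      rw [ZMod.intCast_zmod_eq_zero_iff_dvd] at this
      obtain ⟨m, hm⟩ := this
      refine ⟨m, ?_⟩
      push_cast at hm
      linarith
    obtain ⟨z, hz, h1, h2⟩ := exists_mem_half_circles s.start.val x s.len t.len
      (by exact_mod_cast hx) (by exact_mod_cast hxs) (by exact_mod_cast hs)
    refine Set.disjoint_left.1 h ⟨z, ⟨hz, by simpa only [Complex.ofReal_natCast] using h1⟩, rfl⟩
      ⟨z + m * (n + 1), ⟨by simpa using hz, ?_⟩, ?_⟩
    · have hm' : (t.start.val : ℂ) = s.start.val + x + m * (n + 1) := by exact_mod_cast hm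
      rw [hm', ← h2]
      congr 1
      push_cast
      ring
    · refine Complex.exp_eq_exp_iff_exists_int.2 ⟨m, ?_⟩
      have : (n : ℂ) + 1 ≠ 0 := by exact_mod_cast n.succ_ne_zero
      field_simp

end Crossing

namespace Triangulation

variable {n : ℕ} {τ : Triangulation n}

theorem not_crossing {s t : Segment n} (hs : s.IsBoundary ∨ s ∈ τ.arcs)
    (ht : t.IsBoundary ∨ t ∈ τ.arcs) (x : ℕ)
    (hst : t.start = s.start + x) (hx : 0 < x) (hxs : x < s.len) : x + t.len ≤ s.len := by
  by_contra! h
  rcases hs with hs | hs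
  · unfold Segment.IsBoundary at hs
    omega
  rcases ht with ht | ht
  · unfold Segment.IsBoundary at ht
    omega
  exact Segment.not_compatible_of_crossing x hst hx hxs h (τ.compatible _ hs _ ht)

/-! ### Triangles are determined by a side and its position -/

namespace Triangle

theorem ext' {Δ Δ' : τ.Triangle} (hs : Δ.start = Δ'.start) (hd : Δ.d = Δ'.d) (he : Δ.e = Δ'.e) :
    Δ = Δ' := by
  obtain ⟨⟨a, d, e, _, _, _⟩, _⟩ := Δ
  obtain ⟨⟨a', d', e', _, _, _⟩, _⟩ := Δ'
  simp only at hs hd he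
  subst hs hd he
  rfl

theorem side_zero_len (Δ : τ.Triangle) : (Δ.side 0).len = Δ.d + Δ.e := rfl
theorem side_one_len (Δ : τ.Triangle) : (Δ.side 1).len = Δ.e := rfl
theorem side_two_len (Δ : τ.Triangle) : (Δ.side 2).len = Δ.d := rfl
theorem side_zero_start (Δ : τ.Triangle) : (Δ.side 0).start = Δ.start := rfl
theorem side_one_start (Δ : τ.Triangle) : (Δ.side 1).start = Δ.start + Δ.d := rfl
theorem side_two_start (Δ : τ.Triangle) : (Δ.side 2).start = Δ.start := rfl

/-- Otherwise side 1 of `Δ` starts strictly inside the span of side 2 of `Δ'` and ends beyond it.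
The analogues for sides 1 and 2 use other crossing pairs. -/
theorem d_le_of_side_zero_eq {Δ Δ' : τ.Triangle} (h : Δ.side 0 = Δ'.side 0) : Δ'.d ≤ Δ.d := by
  have hs : Δ.start = Δ'.start := congrArg Segment.start h
  have hl : Δ.d + Δ.e = Δ'.d + Δ'.e := congrArg Segment.len h
  by_contra! hlt
  have := not_crossing (Δ'.side_mem 2) (Δ.side_mem 1) Δ.d
    (by rw [side_one_start, side_two_start, hs]) Δ.one_le_d hlt
  rw [side_one_len, side_two_len] at this
  have := Δ'.one_le_e
  omega

theorem eq_of_side_zero_eq {Δ Δ' : τ.Triangle} (h : Δ.side 0 = Δ'.side 0) : Δ = Δ' := by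
  have hd := le_antisymm (d_le_of_side_zero_eq h.symm) (d_le_of_side_zero_eq h)
  have hl : Δ.d + Δ.e = Δ'.d + Δ'.e := congrArg Segment.len h
  exact ext' (congrArg Segment.start h) hd (by omega)

theorem d_le_of_side_one_eq {Δ Δ' : τ.Triangle} (h : Δ.side 1 = Δ'.side 1) : Δ'.d ≤ Δ.d := by
  have hs : Δ.start + Δ.d = Δ'.start + Δ'.d := congrArg Segment.start h
  by_contra! hlt
  have := not_crossing (Δ'.side_mem 2) (Δ.side_mem 0) (Δ'.d - Δ.d)
    (by
      rw [side_zero_start, side_two_start, Nat.cast_sub hlt.le, ← add_sub_assoc, ← hs,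
        add_sub_cancel_right])
    (by omega) (by rw [side_two_len]; have := Δ.one_le_d; omega)
  rw [side_zero_len, side_two_len] at this
  have := Δ.one_le_e
  omega

theorem eq_of_side_one_eq {Δ Δ' : τ.Triangle} (h : Δ.side 1 = Δ'.side 1) : Δ = Δ' := by
  have hd := le_antisymm (d_le_of_side_one_eq h.symm) (d_le_of_side_one_eq h)
  have hs : Δ.start + Δ.d = Δ'.start + Δ'.d := congrArg Segment.start h
  rw [hd] at hs
  exact ext' (add_right_cancel hs) hd (congrArg Segment.len h)

theorem e_le_of_side_two_eq {Δ Δ' : τ.Triangle} (h : Δ.side 2 = Δ'.side 2) : Δ'.e ≤ Δ.e := by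
  have hs : Δ.start = Δ'.start := congrArg Segment.start h
  have hd : Δ.d = Δ'.d := congrArg Segment.len h
  by_contra! hlt
  have := not_crossing (Δ.side_mem 0) (Δ'.side_mem 1) Δ.d
    (by rw [side_zero_start, side_one_start, hs, hd]) Δ.one_le_d
    (by rw [side_zero_len]; have := Δ.one_le_e; omega)
  rw [side_zero_len, side_one_len] at this
  omega

theorem eq_of_side_two_eq {Δ Δ' : τ.Triangle} (h : Δ.side 2 = Δ'.side 2) : Δ = Δ' :=
  ext' (congrArg Segment.start h) (congrArg Segment.len h)
    (le_antisymm (e_le_of_side_two_eq h.symm) (e_le_of_side_two_eq h))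

/-- The long sides would cross: that of `Δ` reaches back before the common arc, that of `Δ'` reaches
beyond it. -/
theorem side_one_ne_side_two (Δ Δ' : τ.Triangle) : Δ.side 1 ≠ Δ'.side 2 := by
  intro h
  have hs : Δ.start + Δ.d = Δ'.start := congrArg Segment.start h
  have hl : Δ.e = Δ'.d := congrArg Segment.len h
  have := not_crossing (Δ.side_mem 0) (Δ'.side_mem 0) Δ.d
    (by rw [side_zero_start, side_zero_start, hs]) Δ.one_le_d
    (by rw [side_zero_len]; have := Δ.one_le_e; omega)
  rw [side_zero_len, side_zero_len] at this
  have := Δ'.one_le_e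
  omega

theorem eq_zero_of_isPending_side (Δ : τ.Triangle) (k : Fin 3) (h : (Δ.side k).IsPending) :
    k = 0 := by
  have := Δ.one_le_d
  have := Δ.one_le_e
  have := Δ.add_le
  unfold Segment.IsPending at h
  match k, h with
  | 0, _ => rfl
  | 1, h => rw [side_one_len] at h; omega
  | 2, h => rw [side_two_len] at h; omega

end Triangle

/-! ### The relations -/

/-- An arrow of `Q(τ)` is determined by a triangle and the position of its source,
or is the loop at a pending arc. -/
def label : AnyArrow τ.Vertex → (τ.Triangle × Fin 3) ⊕ τ.Vertex
  | ⟨_, _, .ofTriangle Δ k _ _⟩ => .inl (Δ, k)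
  | ⟨_, _, .loop i _⟩ => .inr i

theorem label_injective : Function.Injective (label (τ := τ)) := by
  rintro ⟨_, _, ⟨Δ, k, _, _⟩ | ⟨i, _⟩⟩ ⟨_, _, ⟨Δ', k', _, _⟩ | ⟨i', _⟩⟩ h
  · simp only [label, Sum.inl.injEq, Prod.mk.injEq] at h
    obtain ⟨rfl, rfl⟩ := h
    rfl
  · simp [label] at h
  · simp [label] at h
  · simp only [label, Sum.inr.injEq] at h
    subst h
    rfl

instance : Finite (Segment n) := by
  refine Finite.of_injective (β := ZMod (n + 1) × Fin (n + 2))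
    (fun s => (s.start, ⟨s.len, by have := s.len_le; omega⟩)) fun s t h => ?_
  simp only [Prod.mk.injEq, Fin.mk.injEq] at h
  exact Segment.ext h.1 h.2

instance : Finite (Triple n) := by
  refine Finite.of_injective (β := ZMod (n + 1) × Fin (n + 2) × Fin (n + 2))
    (fun s => (s.start, ⟨s.d, by have := s.add_le; omega⟩, ⟨s.e, by have := s.add_le; omega⟩))
    fun s t h => ?_
  simp only [Prod.mk.injEq, Fin.mk.injEq] at h
  exact Triple.ext h.1 h.2.1 h.2.2

instance : Finite τ.Triangle :=
  Finite.of_injective Triangle.toTriple fun Δ Δ' h => by cases Δ; cases Δ'; cases h; rfl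

instance : Finite τ.Vertex := Finite.of_injective Vertex.arc fun _ _ h => Vertex.ext h

instance : Finite (AnyArrow τ.Vertex) := Finite.of_injective label label_injective

theorem exists_eq_ofTriangle {x : AnyArrow τ.Vertex} {Δ : τ.Triangle} {k : Fin 3}
    (hx : label x = .inl (Δ, k)) :
    ∃ (h : Δ.side k ∈ τ.arcs) (h' : Δ.side (k + 1) ∈ τ.arcs),
      x = ⟨⟨Δ.side k, h⟩, ⟨Δ.side (k + 1), h'⟩, Arrow.ofTriangle Δ k h h'⟩ := by
  obtain ⟨_, _, ⟨Δ', k', h, h'⟩ | ⟨i, _⟩⟩ := x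
  · simp only [label, Sum.inl.injEq, Prod.mk.injEq] at hx
    obtain ⟨rfl, rfl⟩ := hx
    exact ⟨h, h', rfl⟩
  · simp [label] at hx

theorem exists_eq_loop {x : AnyArrow τ.Vertex} {i : τ.Vertex} (hx : label x = .inr i) :
    ∃ h : i.arc.IsPending, x = ⟨i, i, Arrow.loop i h⟩ := by
  obtain ⟨_, _, ⟨Δ', k', h, h'⟩ | ⟨j, h⟩⟩ := x
  · simp [label] at hx
  · simp only [label, Sum.inr.injEq] at hx
    subst hx
    exact ⟨h, rfl⟩

theorem eq_triangleCycle_iff (Δ : τ.Triangle) (i : τ.Vertex) (c : Quiver.Path i i) :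
    (∃ h : Δ.IsInternal, ⟨i, c⟩ = τ.triangleCycle Δ h) ↔
      (word c).map label = [.inl (Δ, 2), .inl (Δ, 1), .inl (Δ, 0)] := by
  have hl : ∀ h, (word (τ.triangleCycle Δ h).2).map label =
      [.inl (Δ, 2), .inl (Δ, 1), .inl (Δ, 0)] := fun _ => rfl
  constructor
  · rintro ⟨h, hc⟩
    rw [← hl h, ← hc]
  · intro hw
    -- The arrows starting at sides 2 and 1 already witness that all three sides are arcs.
    have h : Δ.IsInternal := by
      obtain ⟨x, w, hx, h2, hw⟩ := List.map_eq_cons_iff.1 hw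
      obtain ⟨y, w, hy, h1, hw⟩ := List.map_eq_cons_iff.1 hw
      obtain ⟨h2, h0, -⟩ := exists_eq_ofTriangle h2
      obtain ⟨h1, -, -⟩ := exists_eq_ofTriangle h1
      intro k
      match k with
      | 0 => exact h0
      | 1 => exact h1
      | 2 => exact h2
    refine ⟨h, (cycle_eq_iff_word_eq c (τ.triangleCycle Δ h).2 (by simp [triangleCycle])).2 ?_⟩
    exact label_injective.list_map (hw.trans (hl h).symm)

theorem eq_loopCycle_iff (j i : τ.Vertex) (c : Quiver.Path i i) :
    (∃ h : j.arc.IsPending, ⟨i, c⟩ = τ.loopCycle j h) ↔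
      (word c).map label = [.inr j, .inr j, .inr j] := by
  have hl : ∀ h, (word (τ.loopCycle j h).2).map label = [.inr j, .inr j, .inr j] := fun _ => rfl
  constructor
  · rintro ⟨h, hc⟩
    rw [← hl h, ← hc]
  · intro hw
    have h : j.arc.IsPending := by
      obtain ⟨x, w, hx, h2, hw⟩ := List.map_eq_cons_iff.1 hw
      exact (exists_eq_loop h2).1
    refine ⟨h, (cycle_eq_iff_word_eq c (τ.loopCycle j h).2 (by simp [loopCycle])).2 ?_⟩
    exact label_injective.list_map (hw.trans (hl h).symm)

-- Labels turn membership of a cycle in the potential into an equality of lists, free of dependent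
-- types. The base point matters: only the rotation starting at side 0 has coefficient one.
open Classical in
theorem potential_apply (i : τ.Vertex) (c : Quiver.Path i i) :
    τ.potential i c =
      if (∃ Δ : τ.Triangle, (word c).map label = [.inl (Δ, 2), .inl (Δ, 1), .inl (Δ, 0)]) ∨
        (∃ j : τ.Vertex, (word c).map label = [.inr j, .inr j, .inr j]) then 1 else 0 := by
  simp only [← eq_triangleCycle_iff, ← eq_loopCycle_iff]
  rw [potential, sumOfCycles, Set.indicator_apply]
  exact if_congr Iff.rfl rfl rfl

theorem potential_apply_of_length_ne (i : τ.Vertex) (c : Quiver.Path i i) (hc : c.length ≠ 3) :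
    τ.potential i c = 0 := by
  rw [potential_apply, if_neg]
  rintro (⟨_, h⟩ | ⟨_, h⟩) <;>
  · apply_fun List.length at h
    rw [List.length_map, length_word] at h
    exact hc h

theorem cyclicDerivative_triangle {Δ : τ.Triangle} {k : Fin 3} {α β γ : AnyArrow τ.Vertex}
    (hα : label α = .inl (Δ, k)) (hβ : label β = .inl (Δ, k + 1))
    (hγ : label γ = .inl (Δ, k + 2)) :
    cyclicDerivative γ.2.2 τ.potential = arrowElement β * arrowElement α := by
  classical
  funext i j p
  rw [arrowElement_mul_arrowElement_apply]
  by_cases hp : p.length = 2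
  swap
  · rw [cyclicDerivative_apply_of_length_ne_two _ potential_apply_of_length_ne _ _ hp, if_neg]
    intro h
    rw [← length_word, h] at hp
    exact hp rfl
  have hαγ : γ.2.1 = α.1 := by
    obtain ⟨_, _, rfl⟩ := exists_eq_ofTriangle hα
    obtain ⟨_, _, rfl⟩ := exists_eq_ofTriangle hγ
    refine Vertex.ext ?_
    change Δ.side (k + 2 + 1) = Δ.side k
    congr 1
    omega
  have hβγ : β.2.1 = γ.1 := by
    obtain ⟨_, _, rfl⟩ := exists_eq_ofTriangle hβ
    obtain ⟨_, _, rfl⟩ := exists_eq_ofTriangle hγ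
    refine Vertex.ext ?_
    change Δ.side (k + 1 + 1) = Δ.side (k + 2)
    congr 1
    omega
  by_cases hij : i = γ.2.1 ∧ j = γ.1
  swap
  · rw [cyclicDerivative, dif_neg hij, if_neg]
    exact fun h => hij ⟨(eq_source_of_word (w := [β]) h).trans hαγ.symm,
      (eq_target_of_word h).trans hβγ⟩
  obtain ⟨s, t, c⟩ := γ
  obtain ⟨rfl, rfl⟩ := hij
  match p, hp with
  | .cons (.cons .nil e) f, _ =>
    refine (cyclicDerivative_apply_cons_cons _ _ _ _).trans ?_
    simp only [potential_apply, word_cons, word_nil, List.map_cons, List.map_nil, hγ,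
      List.cons.injEq, and_true, ← label_injective.eq_iff (b := α),
      ← label_injective.eq_iff (b := β), hα, hβ]
    generalize label ⟨_, _, e⟩ = A
    generalize label ⟨_, _, f⟩ = B
    -- The value of `k` decides which one of the three rotations starts at side 0 and can
    -- contribute.
    fin_cases k <;> simp [and_comm]

theorem cyclicDerivative_loop (i : τ.Vertex) (h : i.arc.IsPending) :
    cyclicDerivative (τ.loopArrow i h) τ.potential =
      (3 : ℂ) • (arrowElement ⟨i, i, τ.loopArrow i h⟩ * arrowElement ⟨i, i, τ.loopArrow i h⟩) := by
  classical
  funext j k p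
  change _ = 3 * (_ : ℂ)
  rw [arrowElement_mul_arrowElement_apply]
  by_cases hp : p.length = 2
  swap
  · rw [cyclicDerivative_apply_of_length_ne_two _ potential_apply_of_length_ne _ _ hp, if_neg,
      mul_zero]
    intro h
    rw [← length_word, h] at hp
    exact hp rfl
  by_cases hij : j = i ∧ k = i
  swap
  · rw [cyclicDerivative, dif_neg hij, if_neg, mul_zero]
    exact fun h => hij ⟨eq_source_of_word (w := [_]) h, eq_target_of_word h⟩
  obtain ⟨rfl, rfl⟩ := hij
  match p, hp with
  | .cons (.cons .nil e) f, _ =>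
    refine (cyclicDerivative_apply_cons_cons _ _ _ _).trans ?_
    have hl : label (⟨k, k, τ.loopArrow k h⟩ : AnyArrow τ.Vertex) = .inr k := rfl
    simp only [potential_apply, word_cons, word_nil, List.map_cons, List.map_nil, hl,
      List.cons.injEq, and_true, ← label_injective.eq_iff (b := ⟨k, k, τ.loopArrow k h⟩)]
    generalize label ⟨_, _, e⟩ = A
    generalize label ⟨_, _, f⟩ = B
    -- All rotations of `ε³` coincide, so each of the three terms contributes; this is the factor 3.
    by_cases hA : A = .inr k <;> by_cases hB : B = .inr k <;> (simp [hA, hB]; try norm_num)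

/-- Two consecutive arrows touch all three sides, so the triangle is internal and the third arrow
exists; the product is the derivative with respect to it. -/
theorem arrowElement_mul_mem_of_triangle {Δ : τ.Triangle} {k : Fin 3} {α β : AnyArrow τ.Vertex}
    (hα : label α = .inl (Δ, k)) (hβ : label β = .inl (Δ, k + 1)) :
    arrowElement β * arrowElement α ∈ jacobianIdeal τ.potential := by
  obtain ⟨h0, h1, -⟩ := exists_eq_ofTriangle hα
  obtain ⟨_, h2, -⟩ := exists_eq_ofTriangle hβ
  have h2' : Δ.side (k + 2) ∈ τ.arcs := by
    convert h2 using 2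
    omega
  have h0' : Δ.side (k + 2 + 1) ∈ τ.arcs := by
    convert h0 using 2
    omega
  rw [← cyclicDerivative_triangle (γ := ⟨_, _, Arrow.ofTriangle Δ (k + 2) h2' h0'⟩) hα hβ rfl]
  exact cyclicDerivative_mem_jacobianIdeal _ _

theorem arrowElement_mul_mem_of_loop {α β : AnyArrow τ.Vertex} {i : τ.Vertex}
    (hα : label α = .inr i) (hβ : label β = .inr i) :
    arrowElement β * arrowElement α ∈ jacobianIdeal τ.potential := by
  obtain ⟨h, rfl⟩ := exists_eq_loop hα
  obtain ⟨-, rfl⟩ := exists_eq_loop hβ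
  have := (jacobianIdeal τ.potential).mul_mem_left (algebraMap ℂ _ (3 : ℂ)⁻¹) _
    (cyclicDerivative_mem_jacobianIdeal τ.potential (τ.loopArrow i h))
  rwa [cyclicDerivative_loop, ← Algebra.smul_def, smul_smul, inv_mul_cancel₀ three_ne_zero,
    one_smul] at this

/-! ### Bounding the length of nonzero paths

A nonzero path first climbs towards the pending arc, then turns once, and then descends. -/

/-- A rank which increases along nonzero paths. -/
def rank : (τ.Triangle × Fin 3) ⊕ τ.Vertex → ℕ
  -- Climbing arrows (position 2) have the length of their target, at most `n + 1`; turns (position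
  -- 1 and the loop) come next with `n + 2`; descending arrows (position 0) start above that and
  -- gain as their target, of length `e`, gets shorter.
  | .inl (Δ, 0) => n + 3 + (n + 1 - Δ.e)
  | .inl (_, 1) => n + 2
  | .inl (Δ, 2) => Δ.d + Δ.e
  | .inr _ => n + 2

theorem rank_le (x : (τ.Triangle × Fin 3) ⊕ τ.Vertex) : rank x ≤ 2 * n + 4 := by
  match x with
  | .inl (Δ, 0) => simp only [rank]; omega
  | .inl (_, 1) => simp only [rank]; omega
  | .inl (Δ, 2) => have := Δ.add_le; simp only [rank]; omega
  | .inr _ => simp only [rank]; omega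

/-- If the common arc has the same position in both triangles, they agree; positions 1 and 2 exclude
each other; in the remaining cases the path passes between position 0 and position 1 or 2, and the
rank grows. -/
theorem rank_lt_or_eq {Δ Δ' : τ.Triangle} {k k' : Fin 3} (h : Δ.side (k + 1) = Δ'.side k') :
    rank (.inl (Δ, k)) < rank (.inl (Δ', k') : (τ.Triangle × Fin 3) ⊕ τ.Vertex) ∨
      (Δ = Δ' ∧ k' = k + 1) := by
  have := Δ.one_le_d
  have := Δ.one_le_e
  have := Δ.add_le
  have := Δ'.one_le_d
  have := Δ'.one_le_e
  have := Δ'.add_le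
  have hl := congrArg Segment.len h
  match k, k' with
  | 0, 0 =>
    left
    change Δ.e = Δ'.d + Δ'.e at hl
    simp only [rank]
    omega
  | 0, 1 => exact .inr ⟨Triangle.eq_of_side_one_eq h, rfl⟩
  | 0, 2 => exact absurd h (Triangle.side_one_ne_side_two _ _)
  | 1, 0 =>
    left
    simp only [rank]
    omega
  | 1, 1 => exact absurd h.symm (Triangle.side_one_ne_side_two _ _)
  | 1, 2 => exact .inr ⟨Triangle.eq_of_side_two_eq h, rfl⟩
  | 2, 0 => exact .inr ⟨Triangle.eq_of_side_zero_eq h, rfl⟩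
  | 2, 1 =>
    left
    simp only [rank]
    omega
  | 2, 2 =>
    left
    change Δ.d + Δ.e = Δ'.d at hl
    simp only [rank]
    omega

theorem rank_lt_or_mul_mem (a b : AnyArrow τ.Vertex) :
    rank (label b) < rank (label a) ∨
      arrowElement a * arrowElement b ∈ jacobianIdeal τ.potential := by
  by_cases hab : a.1 = b.2.1
  swap
  · right
    rw [arrowElement_mul_arrowElement_eq_zero hab]
    exact (jacobianIdeal τ.potential).zero_mem
  have harc := congrArg Vertex.arc hab
  rcases ha : label a with ⟨Δ', k'⟩ | i' <;> rcases hb : label b with ⟨Δ, k⟩ | i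
  · obtain ⟨_, _, rfl⟩ := exists_eq_ofTriangle ha
    obtain ⟨_, _, rfl⟩ := exists_eq_ofTriangle hb
    rcases rank_lt_or_eq harc.symm with h | ⟨rfl, rfl⟩
    · exact .inl h
    · exact .inr (arrowElement_mul_mem_of_triangle hb ha)
  · left
    obtain ⟨_, _, rfl⟩ := exists_eq_ofTriangle ha
    obtain ⟨h, rfl⟩ := exists_eq_loop hb
    change Δ'.side k' = i.arc at harc
    -- After the loop only a descent is possible, and before it, in the next case, only a climb.
    obtain rfl := Δ'.eq_zero_of_isPending_side k' (harc ▸ h)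
    simp only [rank]
    omega
  · left
    obtain ⟨h, rfl⟩ := exists_eq_loop ha
    obtain ⟨_, _, rfl⟩ := exists_eq_ofTriangle hb
    change i'.arc = Δ.side (k + 1) at harc
    obtain rfl : k = 2 := by
      have := Δ.eq_zero_of_isPending_side (k + 1) (harc ▸ h)
      omega
    have := Δ.add_le
    simp only [rank]
    omega
  · right
    obtain ⟨h, rfl⟩ := exists_eq_loop ha
    obtain ⟨h', rfl⟩ := exists_eq_loop hb
    obtain rfl : i' = i := hab
    exact arrowElement_mul_mem_of_loop hb ha

end Triangulation

end OrbifoldPolygon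

end

theorem mainTheorem12 (n : ℕ) (hn : 2 ≤ n) (τ : OrbifoldPolygon.Triangulation n) :
    FiniteDimensional ℂ τ.Lam := by
  open OrbifoldPolygon Triangulation in
  exact finiteDimensional_jacobianAlgebra τ.potential (2 * n + 4 + 2)
    (arrowIdealPow_le_of_forall_word _ _ fun w hw =>
      prod_mem_of_rank _ (fun a => rank (label a)) (2 * n + 4) (fun a => rank_le _)
        rank_lt_or_mul_mem w hw)
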